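/- Let $E_4=1+240\sum_{n\ge1}\sigma_3(n)q^n$, $E_6=1-504\sum_{n\ge1}\sigma_5(n)q^n$, $\Delta=(E_4^3-E_6^2)/1728=q+\cdots$ and $j=E_4^3/\Delta=q^{-1}+744+\cdots$ be the usual $q$-series, and write $a_n(f)$ for the coefficient of $q^n$ in a $q$-series $f$. Let $p$ be a prime with $p\nmid 6$. Let $\overline{\mathbb{Z}_p}$ be the integral closure of $\mathbb{Z}_p$ in an algebraic closure $\overline{\mathbb{Q}_p}$ of $\mathbb{Q}_p$, and let $v_p$ denote the $p$-adic valuation. (1) For every $c\in\overline{\mathbb{Z}_p}$ with $v_p(c)=0$ and every integer $l\ge1$, the coefficient $a_{p^l}$ of $\frac{E_4}{j-c}$ (a quotient of Laurent series in $q$ over $\overline{\mathbb{Q}_p}$) satisfies $$a_{p^l}\!\left(\frac{E_4}{j-c}\right)\equiv\bigl(c(c-1728)\bigr)^{\frac{p^l-1}{2}}\cdot\sum_{m=0}^{p^l-1}\frac{(6m)!}{(m!)^3(3m)!}\,c^{-m}\pmod p,$$ where both sides lie in $\overline{\mathbb{Z}_p}$ and the congruence means that their difference lies in $p\,\overline{\mathbb{Z}_p}$.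 (2) In particular, for every $c\in\mathbb{Q}$ with $v_p(c)=0$, $$a_{p}\!\left(\frac{E_4}{j-c}\right)\equiv\bigl(c(c-1728)\bigr)^{\frac{p-1}{2}}\cdot\sum_{m=0}^{p-1}\frac{(6m)!}{(m!)^3(3m)!}\,c^{-m}\pmod p,$$ where both sides lie in $\mathbb{Z}_{(p)}$ and the congruence means that their difference lies in $p\,\mathbb{Z}_{(p)}$. -/

import Mathlib

open scoped PowerSeries LaurentSeries ArithmeticFunction.sigma MatrixGroups

noncomputable section

namespace MeroForm

section QSeries

variable (K : Type*) [Field K]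

/-- The `q`-series `E₄ = 1 + 240 ∑_{n ≥ 1} σ₃(n) qⁿ`, with coefficients in `K`. -/
def E4 : K⟦X⟧ :=
  PowerSeries.mk fun n => if n = 0 then 1 else 240 * (σ 3 n : K)

/-- The `q`-series `E₆ = 1 - 504 ∑_{n ≥ 1} σ₅(n) qⁿ`, with coefficients in `K`. -/
def E6 : K⟦X⟧ :=
  PowerSeries.mk fun n => if n = 0 then 1 else -504 * (σ 5 n : K)

/-- The `q`-series `Δ = (E₄³ - E₆²) / 1728 = q + ⋯` (for `K` of characteristic zero). -/
def Delta : K⟦X⟧ :=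
  PowerSeries.C ((1728 : K)⁻¹) * (E4 K ^ 3 - E6 K ^ 2)

/-- The `q`-series `j = E₄³ / Δ = q⁻¹ + 744 + ⋯` of the modular invariant, a Laurent series. -/
def j : K⸨X⸩ :=
  (E4 K : K⸨X⸩) ^ 3 / (Delta K : K⸨X⸩)

variable {K}

/-- The `q`-series `F_{4,c} = E₄ / (j - c)`; the quotient is taken in the field of Laurent series
in `q` with coefficients in `K`. -/
def F4 (c : K) : K⸨X⸩ :=
  (E4 K : K⸨X⸩) / (j K - HahnSeries.C c)

/-- The `n`-th coefficient `a_n(f)` of a `q`-series `f = ∑ a_n(f) qⁿ`. -/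
def a (n : ℕ) (f : K⸨X⸩) : K :=
  f.coeff (n : ℤ)

/-- `x ≡ y (mod m)` in the subring `R` of `K`: both sides lie in `R`, and `x - y ∈ mR`. -/
def CongrIn (R : Subring K) (m x y : K) : Prop :=
  x ∈ R ∧ y ∈ R ∧ ∃ d ∈ R, x - y = m * d

end QSeries

/-- The ring of `p`-adic algebraic integers: the integral closure of `ℤ_p` in an algebraic closure
of `ℚ_p`. -/
def ZpBar (p : ℕ) [Fact p.Prime] : Subring (PadicAlgCl p) :=
  (integralClosure ℤ_[p] (PadicAlgCl p)).toSubring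

/-- The local ring of rational numbers that are integral at `p`. -/
def ZLoc (p : ℕ) [Fact p.Prime] : Subring ℚ :=
  (Rat.padicValuation p).integer

section Compatibility

open ModularForm UpperHalfPlane

/-- Over `ℂ`, `E4` is the `q`-expansion of the level one Eisenstein series of weight `4`. -/
theorem E4_eq_qExpansion : E4 ℂ = qExpansion 1 E₄ := by
  ext n
  rw [EisensteinSeries.E_qExpansion_coeff (by norm_num) (by decide), E4, PowerSeries.coeff_mk]
  have : bernoulli 4 = -1 / 30 := by decide +kernel
  rw [this]
  norm_num

/-- Over `ℂ`, `E6` is the `q`-expansion of the level one Eisenstein series of weight `6`. -/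
theorem E6_eq_qExpansion : E6 ℂ = qExpansion 1 E₆ := by
  ext n
  rw [EisensteinSeries.E_qExpansion_coeff (by norm_num) (by decide), E6, PowerSeries.coeff_mk]
  have : bernoulli 6 = 1 / 42 := by decide +kernel
  rw [this]
  norm_num

/-- Over `ℂ`, `Delta` is the `q`-expansion of the modular discriminant. -/
theorem Delta_eq_qExpansion : Delta ℂ = qExpansion 1 ModularForm.discriminant := by
  have h : ModularForm.discriminant =
      ⇑((1728 : ℂ)⁻¹ • (ModularForm.mcast (by decide) (E₄.pow 3) -
        ModularForm.mcast (by decide) (E₆.pow 2) : ModularForm 𝒮ℒ 12)) := by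
    ext z
    rw [discriminant_eq_E₄_cube_sub_E₆_sq]
    have h4 : (E₄.pow 3) z = E₄ z ^ 3 := by rw [ModularForm.coe_pow]; rfl
    have h6 : (E₆.pow 2) z = E₆ z ^ 2 := by rw [ModularForm.coe_pow]; rfl
    simp only [FunLike.coe_smul, FunLike.coe_sub, Pi.smul_apply, Pi.sub_apply,
      ModularForm.coe_mcast, h4, h6, smul_eq_mul]
    ring
  rw [h]
  have h1 := ModularForm.qExpansion_smul (h := 1) one_pos one_mem_strictPeriods_SL (1728 : ℂ)⁻¹
    (ModularForm.mcast (by decide) (E₄.pow 3) -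
        ModularForm.mcast (by decide) (E₆.pow 2) : ModularForm 𝒮ℒ 12)
  rw [FunLike.coe_smul, h1, Delta, E4_eq_qExpansion, E6_eq_qExpansion,
    PowerSeries.smul_eq_C_mul]
  simp only [FunLike.coe_sub, ModularForm.coe_mcast,
    ModularForm.qExpansion_sub one_pos one_mem_strictPeriods_SL,
    ModularForm.qExpansion_pow one_pos one_mem_strictPeriods_SL]

/-- The series `Δ` begins `q + ⋯`. -/
theorem coeff_Delta (K : Type*) [Field K] [CharZero K] :
    (Delta K).coeff 0 = 0 ∧ (Delta K).coeff 1 = 1 := by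
  constructor
  · simp [Delta, E4, E6]
  · rw [Delta, PowerSeries.coeff_C_mul]
    norm_num [pow_succ, PowerSeries.coeff_mul, E4, E6, Finset.Nat.antidiagonal_succ]

/-- The denominator `j - c` of `F_{4,c}` is a nonzero Laurent series for every constant `c`. -/
theorem j_sub_ne_zero {K : Type*} [Field K] [CharZero K] (c : K) :
    j K - HahnSeries.C c ≠ 0 := by
  intro h
  have hD : (Delta K : K⸨X⸩) ≠ 0 := by
    intro h0
    have h1 : Delta K = 0 :=
      HahnSeries.ofPowerSeries_injective (Γ := ℤ) (by rw [map_zero]; exact h0)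
    have := (coeff_Delta K).2
    rw [h1] at this
    simp at this
  rw [j, sub_eq_zero, div_eq_iff hD] at h
  have h2 : E4 K ^ 3 = PowerSeries.C c * Delta K := by
    apply HahnSeries.ofPowerSeries_injective (Γ := ℤ)
    rw [map_mul, map_pow, HahnSeries.ofPowerSeries_C]
    exact h
  have h3 := congrArg (PowerSeries.coeff 0) h2
  rw [PowerSeries.coeff_C_mul, (coeff_Delta K).1] at h3
  simp [E4] at h3

end Compatibility

end MeroForm

end

/-!
Write `D = q d/dq` and let `t = 1 / j = Δ / E₄³ = q + ⋯`, a local parameter at the cusp. The proof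
turns the coefficient of `q^P` of `E₄ / (j - c)`, for a power `P` of `p`, into a coefficient in the
variable `t`.

In characteristic zero, Ramanujan's differential equations (`ramanujan`) give `D t = t E₆ / E₄`
(`E4_mul_euler_tSeries`) and show that `√E₄` satisfies, as a function of `t`, the hypergeometric
equation `ϑ³ y = 8 t (6ϑ + 1)(6ϑ + 3)(6ϑ + 5) y` with `ϑ = t d/dt`. Its only power series solution
with constant term `1` is `G = ∑ (6m)! / ((3m)! m!³) tᵐ`, so `E₄ = G(t)²` (`hypSeries_subst_sq`).
Together with `E₆² = E₄³ (1 - 1728 t)` this yields `E₄ / (j - c) = H(t) D t` for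
`H = G / (√(1 - 1728 t) (1 - c t))` (`F4_eq`). Ramanujan's equations themselves follow from the
absence of cusp forms of weight less than `12`, applied to the Serre derivatives of `E₄` and `E₆`
and to `D E₂ - E₂² / 12`.

Since `H(t) D t = D (∫ H)(t)`, its coefficient of `q^P` is `∑ (P / k) H_{k-1} [q^P] tᵏ`, the sum
being over `1 ≤ k ≤ P`; all terms with `k < P` are divisible by `p`, and the term `k = P` is
`H_{P-1}` (`coeff_subst_mul_euler_sub_mem`). Modulo `p` and `t^P`, Frobenius replaces
`1 / √(1 - 1728 t)` by the polynomial `(1 - 1728 t)^((P-1)/2)`, and Kummer's carry criterion shows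
that `G` is congruent to a polynomial of degree at most `(P-1)/2`. Hence, modulo `p`, the number
`H_{P-1}` is the coefficient of `t^(P-1)` in `A / (1 - c t)` for a polynomial `A` of degree at most
`P - 1`, which is `c^(P-1) A(1/c)` (`coeff_densitySeries_sub_mem`).

The argument takes place over any subring of a field of characteristic zero in which the integers
prime to `p` are invertible (`congrIn_coeff_F4`).
-/

noncomputable section

namespace MeroForm

/-! ### Ramanujan's differential equations over the complex numbers -/

section Analytic

open ModularForm UpperHalfPlane Derivative EisensteinSeries
open scoped Manifold

/-- The function `f` on the upper half plane is everywhere the sum of the `q`-series `c`, where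
`q = exp (2πiτ)`. -/
def HasQSeries (f : ℍ → ℂ) (c : ℂ⟦X⟧) : Prop :=
  ∀ τ : ℍ, HasSum (fun m : ℕ => c.coeff m • Function.Periodic.qParam 1 τ ^ m) (f τ)

namespace HasQSeries

variable {f g : ℍ → ℂ} {c d : ℂ⟦X⟧}

theorem sub (hf : HasQSeries f c) (hg : HasQSeries g d) : HasQSeries (f - g) (c - d) := fun τ => by
  simpa [sub_mul] using (hf τ).sub (hg τ)

theorem add (hf : HasQSeries f c) (hg : HasQSeries g d) : HasQSeries (f + g) (c + d) := fun τ => by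
  simpa [add_mul] using (hf τ).add (hg τ)

theorem smul (a : ℂ) (hf : HasQSeries f c) : HasQSeries (a • f) (a • c) := fun τ => by
  simpa [mul_assoc] using (hf τ).mul_left a

theorem mul (hf : HasQSeries f c) (hg : HasQSeries g d) : HasQSeries (f * g) (c * d) := fun τ => by
  have h := (hf τ).summable.norm
  have h' := (hg τ).summable.norm
  have hs := (summable_norm_sum_mul_antidiagonal_of_summable_norm h h').of_norm
  have he := tsum_mul_tsum_eq_tsum_sum_antidiagonal_of_summable_norm h h'
  rw [(hf τ).tsum_eq, (hg τ).tsum_eq] at he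
  have := hs.hasSum
  rw [← he] at this
  refine Eq.mp (congrArg (fun F => HasSum F (f τ * g τ)) (funext fun n => Eq.symm ?_)) this
  rw [PowerSeries.coeff_mul, Finset.sum_smul]
  refine Finset.sum_congr rfl fun x hx => ?_
  rw [← Finset.HasAntidiagonal.mem_antidiagonal.mp hx, pow_add]
  simp only [smul_eq_mul]
  ring

theorem isBoundedAtImInfty (hf : HasQSeries f c) : IsBoundedAtImInfty f :=
  isBoundedAtImInfty_of_hasSum_qExpansion one_pos hf

theorem periodic (hf : HasQSeries f c) : Function.Periodic (f ∘ ofComplex) 1 := by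
  intro w
  by_cases! hw : 0 < w.im
  · have hw' : 0 < (w + 1).im := by simp [hw]
    simp only [Function.comp_apply, ofComplex_apply_of_im_pos hw',
      ofComplex_apply_of_im_pos hw]
    refine (hf ⟨w + 1, hw'⟩).unique ?_
    have h := hf ⟨w, hw⟩
    have hq : Function.Periodic.qParam 1 (w + 1) = Function.Periodic.qParam 1 w := by
      simp [Function.Periodic.qParam, mul_add, Complex.exp_add]
    simpa [hq] using h
  · have hw' : (w + 1).im ≤ 0 := by simpa using hw
    simp [ofComplex_apply_of_im_nonpos hw', ofComplex_apply_of_im_nonpos hw]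

theorem eq_qExpansion (hf : HasQSeries f c) (hol : MDiff f) : c = qExpansion 1 f := by
  have hp : Function.Periodic (f ∘ ofComplex) ((1 : ℝ) : ℂ) := by simpa using hf.periodic
  have ha := analyticAt_cuspFunction_zero one_pos hp hol hf.isBoundedAtImInfty
  have h1 := (hasFPowerSeriesOnBall_cuspFunction one_pos ha hf).hasFPowerSeriesAt
  have h2 := (hasFPowerSeriesOnBall_cuspFunction one_pos ha
    (hasSum_qExpansion one_pos hp hol hf.isBoundedAtImInfty)).hasFPowerSeriesAt
  ext m
  simpa using congr_arg (FormalMultilinearSeries.coeff · m) (h1.eq_formalMultilinearSeries h2)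

/-- Termwise differentiation of a `q`-series with respect to `(2πi)⁻¹ d/dτ = q d/dq`. -/
theorem deriv (hf : HasQSeries f c) (hol : MDiff f) :
    HasQSeries (normalizedDerivOfComplex f) (PowerSeries.X * PowerSeries.derivative ℂ c) := by
  have hp : Function.Periodic (f ∘ ofComplex) ((1 : ℝ) : ℂ) := by simpa using hf.periodic
  have hd := differentiableOn_cuspFunction_ball one_pos hp hol hf.isBoundedAtImInfty
  intro τ
  set g := cuspFunction 1 f with hg
  set q := Function.Periodic.qParam 1 τ with hq
  have hq1 : ‖q‖ < 1 := Function.Periodic.norm_qParam_lt_one one_pos τ.im_pos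
  have hqb : q ∈ Metric.ball (0 : ℂ) 1 := by simpa using hq1
  have h1 := Complex.hasSum_taylorSeries_on_ball (hd.deriv Metric.isOpen_ball) hqb
  -- `f` is `g ∘ q` near `τ`, so its derivative is `q g'(q)` up to the factor `2πi`
  have h2 : normalizedDerivOfComplex f τ = q * _root_.deriv g q := by
    have e : (f ∘ ofComplex) =ᶠ[nhds (τ : ℂ)] fun w => g (Function.Periodic.qParam 1 w) := by
      filter_upwards [isOpen_upperHalfPlaneSet.mem_nhds τ.im_pos] with w hw
      have := eq_cuspFunction ⟨w, hw⟩ one_ne_zero hp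
      simp only [Function.comp_apply, ofComplex_apply_of_im_pos hw]
      exact this.symm
    have hqd : HasDerivAt (fun w : ℂ => Function.Periodic.qParam 1 w)
        (2 * Real.pi * Complex.I * q) τ := by
      have : HasDerivAt (fun w : ℂ => 2 * Real.pi * Complex.I * w / (1 : ℝ))
          (2 * Real.pi * Complex.I) (τ : ℂ) := by
        simpa using (hasDerivAt_id (τ : ℂ)).const_mul (2 * Real.pi * Complex.I)
      simpa [Function.Periodic.qParam, hq, mul_comm] using this.cexp
    have hgd : HasDerivAt g (_root_.deriv g q) q :=
      (hd.differentiableAt (Metric.isOpen_ball.mem_nhds hqb)).hasDerivAt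
    have hcomp := (HasDerivAt.comp (τ : ℂ) (h₂ := g) hgd hqd).deriv
    rw [Function.comp_def] at hcomp
    rw [normalizedDerivOfComplex, e.deriv_eq, hcomp]
    field_simp [Complex.two_pi_I_ne_zero]
  rw [h2]
  have h3 := h1.mul_left q
  rw [← hasSum_nat_add_iff' 1]
  simp only [Finset.range_one, Finset.sum_singleton, pow_zero, PowerSeries.coeff_zero_X_mul,
    zero_smul, sub_zero]
  refine Eq.mp (congrArg (fun F => HasSum F _) (funext fun n => Eq.symm ?_)) h3
  have hc : c.coeff (n + 1) = ((n + 1).factorial : ℂ)⁻¹ * iteratedDeriv (n + 1) g 0 := by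
    rw [hf.eq_qExpansion hol, qExpansion_coeff]
  rw [PowerSeries.coeff_succ_X_mul, PowerSeries.coeff_derivative, hc, iteratedDeriv_succ',
    Nat.factorial_succ]
  have : (n : ℂ) + 1 ≠ 0 := by exact_mod_cast n.succ_ne_zero
  have : (n.factorial : ℂ) ≠ 0 := by exact_mod_cast n.factorial_ne_zero
  push_cast
  simp only [smul_eq_mul, sub_zero]
  field_simp
  ring

/-- A level one form of weight `k < 12` given by a `q`-series without constant term vanishes. -/
theorem eq_zero_of_weight_lt_twelve {k : ℤ} (hk : k < 12) (hf : HasQSeries f c) (hol : MDiff f)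
    (hs : ∀ γ : SL(2, ℤ), f ∣[k] γ = f) (h0 : c.coeff 0 = 0) : c = 0 := by
  let F : ModularForm 𝒮ℒ k :=
    { toFun := f
      slash_action_eq' := fun _ ⟨γ, hγ⟩ => hγ ▸ hs γ
      holo' := hol
      bdd_at_cusps' := fun {c} hc => by
        rw [Subgroup.IsArithmetic.isCusp_iff_isCusp_SL2Z] at hc
        rw [OnePoint.isBoundedAt_iff_forall_SL2Z hc]
        intro γ _
        rw [hs γ]
        exact hf.isBoundedAtImInfty }
  have hc : c = qExpansion 1 F := hf.eq_qExpansion hol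
  have hF : F = 0 := by
    apply sturm_bound_levelOne
    rw [← hc]
    have : k.toNat / 12 = 0 := by omega
    rw [this]
    exact lt_of_lt_of_le (by norm_num) (PowerSeries.nat_le_order c 1 fun i hi => by
      obtain rfl : i = 0 := by omega
      exact h0)
  rw [hc, hF]
  exact qExpansion_zero 1

end HasQSeries

/-- The `q`-series `E₂ = 1 - 24 ∑_{n ≥ 1} σ₁(n) qⁿ`, with coefficients in `K`. -/
def E2 (K : Type*) [Field K] : K⟦X⟧ :=
  PowerSeries.mk fun n => if n = 0 then 1 else -24 * (σ 1 n : K)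

theorem hasQSeries_E2 : HasQSeries EisensteinSeries.E2 (E2 ℂ) := fun τ => by
  have h := hasSum_qExpansion_E2 (z := τ)
  simpa only [E2, PowerSeries.coeff_mk, Function.Periodic.qParam, Complex.ofReal_one, div_one]
    using h

theorem hasQSeries_modularForm {k : ℤ} (f : ModularForm 𝒮ℒ k) :
    HasQSeries f (qExpansion 1 f) := fun τ => by
  simpa using ModularForm.hasSum_qExpansion f one_pos one_mem_strictPeriods_SL τ

theorem hasQSeries_E4 : HasQSeries E₄ (E4 ℂ) := E4_eq_qExpansion ▸ hasQSeries_modularForm E₄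

theorem hasQSeries_E6 : HasQSeries E₆ (E6 ℂ) := E6_eq_qExpansion ▸ hasQSeries_modularForm E₆

theorem HasQSeries.serreDerivative {f : ℍ → ℂ} {c : ℂ⟦X⟧} (k : ℂ) (hf : HasQSeries f c)
    (hol : MDiff f) : HasQSeries (serreDerivative k f)
      (PowerSeries.X * PowerSeries.derivative ℂ c - (k * 12⁻¹) • (E2 ℂ * c)) := by
  have := (hf.deriv hol).sub ((hasQSeries_E2.mul hf).smul (k * 12⁻¹))
  convert this using 1
  ext z
  simp [mul_assoc]

/-- The quasimodularity of `E₂` makes `D E₂ - E₂² / 12` modular of weight four. -/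
theorem deriv_E2_sub_slash (γ : SL(2, ℤ)) :
    (normalizedDerivOfComplex EisensteinSeries.E2 -
      (12⁻¹ : ℂ) • (EisensteinSeries.E2 * EisensteinSeries.E2)) ∣[(4 : ℤ)] γ =
    normalizedDerivOfComplex EisensteinSeries.E2 -
      (12⁻¹ : ℂ) • (EisensteinSeries.E2 * EisensteinSeries.E2) := by
  set κ : ℂ := (2 * Real.pi * Complex.I)⁻¹ with hκ
  -- the cocycle measuring the failure of modularity: `E₂ ∣ γ = E₂ + 12 κ φ` and `D φ = -κ φ²`
  set φ : ℍ → ℂ := fun z => γ 1 0 / denom γ z with hφ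
  have hden : ∀ z : ℍ, HasDerivAt (fun w : ℂ => (γ 1 0 : ℂ) * denom γ w ^ (-1 : ℤ))
      (-(φ z) ^ 2) z := fun z => by
    have h := (hasDerivAt_denom_zpow (γ : GL (Fin 2) ℝ) (-1) z).const_mul (γ 1 0 : ℂ)
    have hz := denom_ne_zero (γ : GL (Fin 2) ℝ) z
    refine h.congr_deriv ?_
    rw [show (-1 - 1 : ℤ) = -2 by norm_num, zpow_neg, hφ]
    simp [div_eq_mul_inv]
    ring
  have hφe : ∀ z : ℍ, (φ ∘ ofComplex) =ᶠ[nhds (z : ℂ)]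
      fun w : ℂ => (γ 1 0 : ℂ) * denom γ w ^ (-1 : ℤ) := fun z => by
    filter_upwards [isOpen_upperHalfPlaneSet.mem_nhds z.im_pos] with w hw
    simp [hφ, ofComplex_apply_of_im_pos hw, div_eq_mul_inv]
  have hφm : MDiff φ := fun z => mdifferentiableAt_iff.mpr
    ((hden z).differentiableAt.congr_of_eventuallyEq (hφe z))
  have hDφ : normalizedDerivOfComplex φ = fun z => -κ * φ z ^ 2 := by
    ext z
    rw [normalizedDerivOfComplex, (hφe z).deriv_eq, (hden z).deriv]
    ring
  have hE : EisensteinSeries.E2 ∣[(2 : ℤ)] γ = EisensteinSeries.E2 + (12 * κ) • φ := by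
    rw [E2_slash_action]
    ext z
    have hpi : (Real.pi : ℂ) ≠ 0 := by exact_mod_cast Real.pi_ne_zero
    have hz := denom_ne_zero (γ : GL (Fin 2) ℝ) z
    simp only [Pi.sub_apply, Pi.add_apply, Pi.smul_apply, smul_eq_mul, D2, hφ, hκ,
      riemannZeta_two]
    field_simp
    linear_combination (-12 * (γ 1 0 : ℂ)) * Complex.I_sq
  have hD := normalizedDerivOfComplex_SL_slash (k := 2) E2_mdifferentiable (γ := γ)
  rw [hE, normalizedDerivOfComplex_add _ _ E2_mdifferentiable (hφm.const_smul _),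
    normalizedDerivOfComplex_smul _ _ hφm, hDφ] at hD
  have hM := ModularForm.mul_slash_SL2 2 2 γ EisensteinSeries.E2 EisensteinSeries.E2
  rw [hE] at hM
  rw [sub_eq_add_neg, SlashAction.add_slash, SlashAction.neg_slash, ModularForm.SL_smul_slash]
  ext z
  have hDz := congrFun hD z
  have hMz := congrFun hM z
  simp only [Pi.add_apply, Pi.sub_apply, Pi.smul_apply, Pi.mul_apply, Pi.neg_apply, smul_eq_mul,
    Int.cast_ofNat, show (2 + 2 : ℤ) = 4 from rfl] at hDz hMz ⊢
  rw [hMz]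
  simp only [← hκ] at hDz
  linear_combination -hDz

theorem E4_slash (γ : SL(2, ℤ)) : (E₄ : ℍ → ℂ) ∣[(4 : ℤ)] γ = E₄ :=
  E₄.slash_action_eq' _ ⟨γ, rfl⟩

theorem E6_slash (γ : SL(2, ℤ)) : (E₆ : ℍ → ℂ) ∣[(6 : ℤ)] γ = E₆ :=
  E₆.slash_action_eq' _ ⟨γ, rfl⟩

/-- Two forms of equal weight `k < 12` with opposite constant terms cancel. -/
theorem HasQSeries.add_eq_zero {f g : ℍ → ℂ} {c d : ℂ⟦X⟧} {k : ℤ} (hk : k < 12)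
    (hf : HasQSeries f c) (hg : HasQSeries g d) (holf : MDiff f) (holg : MDiff g)
    (hsf : ∀ γ : SL(2, ℤ), f ∣[k] γ = f) (hsg : ∀ γ : SL(2, ℤ), g ∣[k] γ = g)
    (h0 : (c + d).coeff 0 = 0) : c + d = 0 :=
  (hf.add hg).eq_zero_of_weight_lt_twelve hk (holf.add holg)
    (fun γ => by rw [SlashAction.add_slash, hsf, hsg]) h0

/-- Ramanujan's differential equations for `E₂`, `E₄`, `E₆` over the complex numbers. -/
theorem ramanujan_complex :
    12 * (PowerSeries.X * PowerSeries.derivative ℂ (E2 ℂ)) = E2 ℂ ^ 2 - E4 ℂ ∧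
    3 * (PowerSeries.X * PowerSeries.derivative ℂ (E4 ℂ)) = E2 ℂ * E4 ℂ - E6 ℂ ∧
    2 * (PowerSeries.X * PowerSeries.derivative ℂ (E6 ℂ)) = E2 ℂ * E6 ℂ - E4 ℂ ^ 2 := by
  have h4 : MDiff (E₄ : ℍ → ℂ) := E₄.holo'
  have h6 : MDiff (E₆ : ℍ → ℂ) := E₆.holo'
  refine ⟨?_, ?_, ?_⟩
  · have hol : MDiff (normalizedDerivOfComplex EisensteinSeries.E2 -
        (12⁻¹ : ℂ) • (EisensteinSeries.E2 * EisensteinSeries.E2)) :=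
      (normalizedDerivOfComplex_mdifferentiable E2_mdifferentiable).sub
        ((E2_mdifferentiable.mul E2_mdifferentiable).const_smul _)
    have h := HasQSeries.add_eq_zero (k := 4) (by norm_num)
      ((hasQSeries_E2.deriv E2_mdifferentiable).sub ((hasQSeries_E2.mul hasQSeries_E2).smul 12⁻¹))
      (hasQSeries_E4.smul 12⁻¹) hol (h4.const_smul _) deriv_E2_sub_slash
      (fun γ => by rw [ModularForm.SL_smul_slash, E4_slash]) (by simp [E2, E4])
    simp only [PowerSeries.smul_eq_C_mul] at h
    have hC : (12 : ℂ⟦X⟧) * PowerSeries.C (12⁻¹ : ℂ) = 1 := by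
      rw [← map_ofNat (PowerSeries.C (R := ℂ)) 12, ← map_mul]; simp
    linear_combination 12 * h + (E2 ℂ * E2 ℂ - E4 ℂ) * hC
  · have h := HasQSeries.add_eq_zero (k := 4 + 2) (by norm_num)
      (hasQSeries_E4.serreDerivative ((4 : ℤ) : ℂ) h4) (hasQSeries_E6.smul 3⁻¹)
      (serreDerivative_mdifferentiable _ h4) (h6.const_smul _)
      (fun γ => serreDerivative_slash_invariant h4 (E4_slash γ))
      (fun γ => by rw [ModularForm.SL_smul_slash]; exact congrArg _ (E6_slash γ))
      (by simp [E2, E4, E6]; norm_num)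
    simp only [PowerSeries.smul_eq_C_mul] at h
    have hC : (3 : ℂ⟦X⟧) * PowerSeries.C (3⁻¹ : ℂ) = 1 := by
      rw [← map_ofNat (PowerSeries.C (R := ℂ)) 3, ← map_mul]; simp
    rw [show ((4 : ℤ) : ℂ) * 12⁻¹ = 3⁻¹ by norm_num] at h
    linear_combination 3 * h + (E2 ℂ * E4 ℂ - E6 ℂ) * hC
  · have h := HasQSeries.add_eq_zero (k := 6 + 2) (by norm_num)
      (hasQSeries_E6.serreDerivative ((6 : ℤ) : ℂ) h6) ((hasQSeries_E4.mul hasQSeries_E4).smul 2⁻¹)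
      (serreDerivative_mdifferentiable _ h6) ((h4.mul h4).const_smul _)
      (fun γ => serreDerivative_slash_invariant h6 (E6_slash γ))
      (fun γ => by
        rw [ModularForm.SL_smul_slash]
        exact congrArg _ ((ModularForm.mul_slash_SL2 4 4 γ E₄ E₄).trans (by rw [E4_slash])))
      (by simp [E2, E4, E6]; norm_num)
    simp only [PowerSeries.smul_eq_C_mul] at h
    have hC : (2 : ℂ⟦X⟧) * PowerSeries.C (2⁻¹ : ℂ) = 1 := by
      rw [← map_ofNat (PowerSeries.C (R := ℂ)) 2, ← map_mul]; simp
    rw [show ((6 : ℤ) : ℂ) * 12⁻¹ = 2⁻¹ by norm_num] at h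
    linear_combination 2 * h + (E2 ℂ * E6 ℂ - E4 ℂ * E4 ℂ) * hC

end Analytic

/-! ### Base change to a field of characteristic zero -/

section BaseChange

variable {K L : Type*} [Field K] [Field L] (φ : K →+* L)

theorem map_E2 : (E2 K).map φ = E2 L := by
  ext n; simp [E2, apply_ite φ, map_ofNat φ]

theorem map_E4 : (E4 K).map φ = E4 L := by
  ext n; simp [E4, apply_ite φ, map_ofNat φ]

theorem map_E6 : (E6 K).map φ = E6 L := by
  ext n; simp [E6, apply_ite φ, map_ofNat φ]

theorem map_X_mul_derivative (f : K⟦X⟧) :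
    (PowerSeries.X * PowerSeries.derivative K f).map φ =
      PowerSeries.X * PowerSeries.derivative L (f.map φ) := by
  rw [map_mul, PowerSeries.map_X]
  congr 1
  ext n
  simp [PowerSeries.coeff_derivative]

/-- Ramanujan's differential equations for `E₂`, `E₄`, `E₆` over a field of characteristic zero. -/
theorem ramanujan (K : Type*) [Field K] [CharZero K] :
    12 * (PowerSeries.X * PowerSeries.derivative K (E2 K)) = E2 K ^ 2 - E4 K ∧
    3 * (PowerSeries.X * PowerSeries.derivative K (E4 K)) = E2 K * E4 K - E6 K ∧
    2 * (PowerSeries.X * PowerSeries.derivative K (E6 K)) = E2 K * E6 K - E4 K ^ 2 := by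
  have hinj := PowerSeries.map_injective (algebraMap ℚ ℂ) (algebraMap ℚ ℂ).injective
  obtain ⟨h2, h4, h6⟩ := ramanujan_complex
  rw [← map_E2 (algebraMap ℚ ℂ), ← map_E4 (algebraMap ℚ ℂ)] at h2 h4 h6
  rw [← map_E6 (algebraMap ℚ ℂ)] at h4 h6
  simp only [← map_X_mul_derivative, ← map_pow, ← map_mul, ← map_sub,
    ← map_ofNat (PowerSeries.map (algebraMap ℚ ℂ))] at h2 h4 h6
  have h2 := congrArg (PowerSeries.map (algebraMap ℚ K)) (hinj h2)
  have h4 := congrArg (PowerSeries.map (algebraMap ℚ K)) (hinj h4)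
  have h6 := congrArg (PowerSeries.map (algebraMap ℚ K)) (hinj h6)
  simp only [map_mul, map_sub, map_pow, map_ofNat, map_E2, map_E4, map_E6] at h2 h4 h6
  simp only [← map_mul, map_X_mul_derivative, map_E2, map_E4, map_E6] at h2 h4 h6
  exact ⟨h2, h4, h6⟩

end BaseChange

open PowerSeries

/-! ### Square roots of power series -/

section SquareRoots

/-- The integral power series `√(1 - 4X) = 1 - 2X·C(X)`, where `C` is the Catalan series. -/
def sqrtSeries : ℤ⟦X⟧ :=
  1 - 2 * (X * catalanSeries.map (Nat.castRingHom ℤ))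

theorem sqrtSeries_sq : sqrtSeries ^ 2 = 1 - 4 * X := by
  have h := congrArg (PowerSeries.map (Nat.castRingHom ℤ)) catalanSeries_sq_mul_X_add_one
  simp only [map_add, map_mul, map_pow, map_X, map_one] at h
  rw [sqrtSeries]
  linear_combination 4 * X * h

theorem constantCoeff_sqrtSeries : constantCoeff sqrtSeries = 1 := by
  simp [sqrtSeries]

/-- The integral power series `1 / √(1 - 4X)`. -/
def invSqrtSeries : ℤ⟦X⟧ :=
  invOfUnit sqrtSeries 1

theorem sqrtSeries_mul_invSqrtSeries : sqrtSeries * invSqrtSeries = 1 :=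
  mul_invOfUnit _ _ (by simp [constantCoeff_sqrtSeries])

theorem invSqrtSeries_sq_mul : invSqrtSeries ^ 2 * (1 - 4 * X) = 1 := by
  rw [← sqrtSeries_sq, ← mul_pow, mul_comm, sqrtSeries_mul_invSqrtSeries, one_pow]

theorem constantCoeff_invSqrtSeries : constantCoeff invSqrtSeries = 1 := by
  simp [invSqrtSeries]

variable {K : Type*} [Field K] [CharZero K]

/-- A power series with constant term `1` over a field of characteristic zero is a square. -/
theorem exists_sq_eq (f : K⟦X⟧) (hf : constantCoeff f = 1) :
    ∃ h : K⟦X⟧, h ^ 2 = f ∧ constantCoeff h = 1 := by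
  have hs : HasSubst (C (4⁻¹ : K) * (1 - f)) := HasSubst.of_constantCoeff_zero' (by simp [hf])
  set s := (sqrtSeries.map (Int.castRingHom K)).subst (C (4⁻¹ : K) * (1 - f)) with hsdef
  have h4 : (4 : K⟦X⟧) * C (4⁻¹ : K) = 1 := by
    rw [← map_ofNat (C (R := K)) 4, ← map_mul]; simp
  have hsq : s ^ 2 = f := by
    have h := congrArg (substAlgHom hs) (congrArg (PowerSeries.map (Int.castRingHom K))
      sqrtSeries_sq)
    simp only [map_sub, map_mul, map_pow, map_X, map_one, map_ofNat, substAlgHom_X,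
      coe_substAlgHom] at h
    rw [← hsdef] at h
    linear_combination h - (1 - f) * h4
  have hc : constantCoeff s ^ 2 = 1 := by rw [← map_pow, hsq, hf]
  rcases mul_self_eq_one_iff.mp ((sq _).symm.trans hc) with h | h
  · exact ⟨s, hsq, h⟩
  · exact ⟨-s, by rw [neg_sq, hsq], by simp [h]⟩

/-- A square root of a power series is determined by its constant term. -/
theorem eq_of_sq_eq_sq_of_constantCoeff {f g : K⟦X⟧} (h : f ^ 2 = g ^ 2)
    (hf : constantCoeff f = 1) (hg : constantCoeff g = 1) : f = g := by
  rcases sq_eq_sq_iff_eq_or_eq_neg.mp h with h | h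
  · exact h
  · have := congrArg constantCoeff h
    rw [map_neg, hf, hg] at this
    exact absurd this (by norm_num)

end SquareRoots

/-! ### The Euler operator -/

section Euler

variable (K : Type*) [Field K]

/-- The Euler operator `X d/dX` on power series. -/
def euler : Derivation K K⟦X⟧ K⟦X⟧ :=
  (X : K⟦X⟧) • derivative K

variable {K}

theorem derivation_ofNat (d : Derivation K K⟦X⟧ K⟦X⟧) (n : ℕ) [n.AtLeastTwo] :
    d ofNat(n) = 0 :=
  d.map_natCast n

theorem euler_apply (f : K⟦X⟧) : euler K f = X * derivative K f := rfl

theorem coeff_euler (f : K⟦X⟧) (n : ℕ) : (euler K f).coeff n = n * f.coeff n := by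
  rw [euler_apply]
  cases n with
  | zero => simp
  | succ n => rw [coeff_succ_X_mul, coeff_derivative]; push_cast; ring

theorem euler_subst {t : K⟦X⟧} (ht : HasSubst t) (f : K⟦X⟧) :
    euler K (f.subst t) = (derivative K f).subst t * euler K t := by
  rw [euler_apply, derivative_subst ht, euler_apply]; ring

end Euler

/-! ### The parameter `1 / j` -/

section Uniformizer

variable (K : Type*) [Field K]

/-- The local parameter `t = 1 / j = Δ / E₄³ = q + ⋯`, as a power series in `q`. -/
def tSeries : K⟦X⟧ :=
  Delta K * (E4 K ^ 3)⁻¹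

/-- The derivation `(E₄ / E₆) q d/dq`, which is the Euler operator `t d/dt` of the parameter
`t = 1 / j`. -/
def theta : Derivation K K⟦X⟧ K⟦X⟧ :=
  (E4 K * (E6 K)⁻¹) • euler K

theorem constantCoeff_E4 : constantCoeff (E4 K) = 1 := by
  rw [← coeff_zero_eq_constantCoeff_apply]; simp [E4]

theorem constantCoeff_E6 : constantCoeff (E6 K) = 1 := by
  rw [← coeff_zero_eq_constantCoeff_apply]; simp [E6]

theorem E4_ne_zero : E4 K ≠ 0 := fun h => by
  simpa [h] using constantCoeff_E4 K

theorem E6_ne_zero : E6 K ≠ 0 := fun h => by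
  simpa [h] using constantCoeff_E6 K

theorem E6_mul_inv : E6 K * (E6 K)⁻¹ = 1 :=
  PowerSeries.mul_inv_cancel _ (by simp [constantCoeff_E6])

theorem tSeries_mul : tSeries K * E4 K ^ 3 = Delta K := by
  rw [tSeries, mul_assoc, PowerSeries.inv_mul_cancel _ (by simp [constantCoeff_E4]), mul_one]

theorem E6_mul_theta (f : K⟦X⟧) : E6 K * theta K f = E4 K * euler K f := by
  rw [theta, Derivation.smul_apply, smul_eq_mul]
  linear_combination E4 K * euler K f * E6_mul_inv K

theorem constantCoeff_tSeries : constantCoeff (tSeries K) = 0 := by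
  simp [tSeries, Delta, constantCoeff_E4, constantCoeff_E6]

theorem hasSubst_tSeries : HasSubst (tSeries K) :=
  HasSubst.of_constantCoeff_zero' (constantCoeff_tSeries K)

variable [CharZero K]

theorem Delta_mul : 1728 * Delta K = E4 K ^ 3 - E6 K ^ 2 := by
  have h : (1728 : K⟦X⟧) * C (1728⁻¹ : K) = 1 := by
    rw [← map_ofNat (C (R := K)) 1728, ← map_mul]; simp
  rw [Delta]
  linear_combination (E4 K ^ 3 - E6 K ^ 2) * h

theorem E6_sq : E6 K ^ 2 = E4 K ^ 3 * (1 - 1728 * tSeries K) := by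
  linear_combination 1728 * tSeries_mul K + Delta_mul K

theorem ofNat_powerSeries_ne_zero (n : ℕ) [n.AtLeastTwo] :
    (OfNat.ofNat n : K⟦X⟧) ≠ 0 := fun h => by
  have := congrArg constantCoeff h
  rw [map_ofNat, map_zero] at this
  exact OfNat.ofNat_ne_zero n this

/-- `E₂` is the logarithmic derivative of `Δ`. -/
theorem euler_Delta : euler K (Delta K) = E2 K * Delta K := by
  obtain ⟨-, h4, h6⟩ := ramanujan K
  have h := congrArg (euler K) (Delta_mul K)
  simp only [map_sub, Derivation.leibniz, Derivation.leibniz_pow, derivation_ofNat,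
    smul_eq_mul, nsmul_eq_mul, mul_zero, add_zero] at h
  push_cast at h
  rw [← euler_apply] at h4 h6
  refine mul_left_cancel₀ (ofNat_powerSeries_ne_zero K 1728) ?_
  linear_combination h + E4 K ^ 2 * h4 - E6 K * h6 - E2 K * Delta_mul K

/-- `q dt/dq = t E₆ / E₄` for `t = 1 / j`. -/
theorem E4_mul_euler_tSeries : E4 K * euler K (tSeries K) = E6 K * tSeries K := by
  obtain ⟨-, h4, h6⟩ := ramanujan K
  have h := congrArg (euler K) (tSeries_mul K)
  simp only [Derivation.leibniz, Derivation.leibniz_pow, smul_eq_mul, nsmul_eq_mul] at h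
  push_cast at h
  rw [← euler_apply] at h4 h6
  refine mul_left_cancel₀ (pow_ne_zero 2 (E4_ne_zero K)) ?_
  rw [euler_Delta, ← tSeries_mul] at h
  linear_combination h - tSeries K * E4 K ^ 2 * h4

theorem theta_tSeries : theta K (tSeries K) = tSeries K := by
  refine mul_left_cancel₀ (E6_ne_zero K) ?_
  rw [E6_mul_theta, E4_mul_euler_tSeries]

/-- The chain rule: `theta` acts on series in `t = 1 / j` as `t d/dt`. -/
theorem theta_subst (f : K⟦X⟧) :
    theta K (f.subst (tSeries K)) = (euler K f).subst (tSeries K) := by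
  have h := theta_tSeries K
  rw [theta, Derivation.smul_apply, smul_eq_mul] at h ⊢
  rw [euler_subst (hasSubst_tSeries K), euler_apply f, subst_mul (hasSubst_tSeries K),
    subst_X (hasSubst_tSeries K)]
  linear_combination ((derivative K f).subst (tSeries K)) * h

end Uniformizer

/-! ### The hypergeometric differential equation -/

section DifferentialEquation

variable {K : Type*} [Field K]

/-- The hypergeometric operator `ϑ³ - 8 t (6ϑ + 1)(6ϑ + 3)(6ϑ + 5)` applied to `y`, with the product
of the three factors multiplied out. -/
def hypergeometricOp (ϑ : K⟦X⟧ → K⟦X⟧) (t y : K⟦X⟧) : K⟦X⟧ :=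
  ϑ (ϑ (ϑ y)) - 8 * t * (216 * ϑ (ϑ (ϑ y)) + 324 * ϑ (ϑ y) + 138 * ϑ y + 15 * y)

theorem X_pow_dvd_theta {n : ℕ} {y : K⟦X⟧} (h : X ^ n ∣ y) : X ^ n ∣ theta K y := by
  rw [theta, Derivation.smul_apply, smul_eq_mul]
  refine Dvd.dvd.mul_left (X_pow_dvd_iff.mpr fun m hm => ?_) _
  rw [coeff_euler, X_pow_dvd_iff.mp h m hm, mul_zero]

/-- `theta` acts on leading terms like `q d/dq`, because `E₄ / E₆ = 1 + O(q)`. -/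
theorem coeff_theta_of_X_pow_dvd {n : ℕ} {y : K⟦X⟧} (h : X ^ n ∣ y) :
    (theta K y).coeff n = n * y.coeff n := by
  have h' : X ^ n ∣ euler K y :=
    X_pow_dvd_iff.mpr fun m hm => by rw [coeff_euler, X_pow_dvd_iff.mp h m hm, mul_zero]
  obtain ⟨u, hu⟩ := h'
  have h1 : constantCoeff (E4 K * (E6 K)⁻¹) = 1 := by
    simp [constantCoeff_E4, constantCoeff_E6]
  have h2 : ∀ v : K⟦X⟧, (X ^ n * v).coeff n = constantCoeff v := fun v => by
    simpa using coeff_X_pow_mul v n 0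
  rw [← coeff_euler, theta, Derivation.smul_apply, smul_eq_mul, hu, mul_left_comm, h2, h2, map_mul,
    h1, one_mul]

variable [CharZero K]

/-- The indicial equation of the hypergeometric operator is `n³ = 0`, so a power series solution
is determined by its constant term. -/
theorem eq_zero_of_hypergeometricOp_eq_zero {y : K⟦X⟧} (h0 : constantCoeff y = 0)
    (h : hypergeometricOp (theta K) (tSeries K) y = 0) : y = 0 := by
  have key : ∀ n, X ^ (n + 1) ∣ y := by
    intro n
    induction n with
    | zero => simpa [X_dvd_iff] using h0
    | succ n ih =>
      have h1 := X_pow_dvd_theta ih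
      have h2 := X_pow_dvd_theta h1
      have h3 := X_pow_dvd_theta h2
      set z := 216 * theta K (theta K (theta K y)) + 324 * theta K (theta K y) +
        138 * theta K y + 15 * y with hz
      have hzd : X ^ (n + 1) ∣ z :=
        (((h3.mul_left _).add (h2.mul_left _)).add (h1.mul_left _)).add (ih.mul_left _)
      have htz : X ^ (n + 2) ∣ 8 * tSeries K * z := by
        rw [show n + 2 = 1 + (n + 1) by omega, pow_add, pow_one]
        exact mul_dvd_mul ((X_dvd_iff.mpr (constantCoeff_tSeries K)).mul_left _) hzd
      have hc := congrArg (PowerSeries.coeff (n + 1)) h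
      rw [hypergeometricOp, ← hz, map_sub, X_pow_dvd_iff.mp htz (n + 1) (by omega), sub_zero,
        coeff_theta_of_X_pow_dvd h2, coeff_theta_of_X_pow_dvd h1, coeff_theta_of_X_pow_dvd ih,
        map_zero] at hc
      have hn : ((n + 1 : ℕ) : K) ≠ 0 := by exact_mod_cast n.succ_ne_zero
      have hy : y.coeff (n + 1) = 0 := by
        simpa only [mul_eq_zero, hn, false_or] using hc
      refine X_pow_dvd_iff.mpr fun m hm => ?_
      rcases Nat.lt_succ_iff_lt_or_eq.mp hm with hm | rfl
      · exact X_pow_dvd_iff.mp ih m hm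
      · exact hy
  ext n
  rw [map_zero]
  exact X_pow_dvd_iff.mp (key n) n (by omega)

/-- `√E₄` satisfies the hypergeometric differential equation in `t = 1 / j`. -/
theorem hypergeometricOp_sqrt_E4 {h : K⟦X⟧} (hh : h ^ 2 = E4 K) :
    hypergeometricOp (theta K) (tSeries K) h = 0 := by
  obtain ⟨r2, r4, r6⟩ := ramanujan K
  rw [← euler_apply] at r2 r4 r6
  have hne : h ≠ 0 := fun h0 => E4_ne_zero K (by rw [← hh, h0]; ring)
  have i6 := E6_mul_inv K
  -- In terms of `x = E₂E₄/E₆` and `w = E₄³/E₆² = 1 / (1 - 1728 t)` the derivation `theta` is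
  -- polynomial
  set x := E2 K * E4 K * (E6 K)⁻¹ with hx
  set w := E4 K ^ 3 * (E6 K)⁻¹ ^ 2 with hw
  have ht : theta K (tSeries K) = tSeries K := theta_tSeries K
  have hwt : w * (1 - 1728 * tSeries K) = 1 := by
    rw [hw]
    linear_combination -(E6 K)⁻¹ ^ 2 * E6_sq K + (E6 K * (E6 K)⁻¹ + 1) * i6
  have θ4 : 3 * theta K (E4 K) = E4 K * (x - 1) := by
    refine mul_left_cancel₀ (E6_ne_zero K) ?_
    rw [hx]
    linear_combination 3 * E6_mul_theta K (E4 K) + E4 K * r4 - E4 K ^ 2 * E2 K * i6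
  have θ6 : 2 * theta K (E6 K) = E6 K * (x - w) := by
    refine mul_left_cancel₀ (E6_ne_zero K) ?_
    rw [hx, hw]
    linear_combination 2 * E6_mul_theta K (E6 K) + E4 K * r6 -
      E4 K * E2 K * E6 K * i6 + E4 K ^ 3 * (E6 K * (E6 K)⁻¹ + 1) * i6
  have θ2 : 12 * E4 K * theta K (E2 K) = E6 K * (x ^ 2 - w) := by
    refine mul_left_cancel₀ (E6_ne_zero K) ?_
    rw [hx, hw]
    linear_combination 12 * E4 K * E6_mul_theta K (E2 K) + E4 K ^ 2 * r2 -
      (E2 K ^ 2 * E4 K ^ 2 - E4 K ^ 3) * (E6 K * (E6 K)⁻¹ + 1) * i6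
  have θx : 12 * theta K x = -x ^ 2 - 4 * x + (6 * x - 1) * w := by
    have hxe : x * E6 K = E2 K * E4 K := by rw [hx]; linear_combination E2 K * E4 K * i6
    have hd := congrArg (theta K) hxe
    simp only [Derivation.leibniz, smul_eq_mul] at hd
    refine mul_left_cancel₀ (E6_ne_zero K) ?_
    linear_combination 12 * hd - 6 * x * θ6 + 4 * E2 K * θ4 + θ2 - 4 * (x - 1) * hxe
  have θw : theta K w = w ^ 2 - w := by
    have hd := congrArg (theta K) hwt
    simp only [Derivation.leibniz, smul_eq_mul, map_sub, Derivation.map_one_eq_zero,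
      derivation_ofNat, ht] at hd
    linear_combination w * hd + (-theta K w - w) * hwt
  have θh : 6 * theta K h = h * (x - 1) := by
    have hd := congrArg (theta K) hh
    simp only [Derivation.leibniz_pow, smul_eq_mul, nsmul_eq_mul] at hd
    push_cast at hd
    refine mul_left_cancel₀ hne ?_
    linear_combination 3 * hd + θ4 - (x - 1) * hh
  have θθh : 72 * theta K (theta K h) =
      h * (2 * (x - 1) ^ 2 + (-x ^ 2 - 4 * x + (6 * x - 1) * w)) := by
    have hd := congrArg (theta K) θh
    simp only [Derivation.leibniz, smul_eq_mul, map_sub, Derivation.map_one_eq_zero,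
      derivation_ofNat] at hd
    linear_combination 12 * hd + h * θx + 2 * (x - 1) * θh
  have θθθh : 864 * theta K (theta K (theta K h)) =
      h * (2 * (x - 1) * (2 * (x - 1) ^ 2 + (-x ^ 2 - 4 * x + (6 * x - 1) * w)) +
        (2 * x - 8 + 6 * w) * (-x ^ 2 - 4 * x + (6 * x - 1) * w) +
        12 * (6 * x - 1) * (w ^ 2 - w)) := by
    have hd := congrArg (theta K) θθh
    simp only [Derivation.leibniz, Derivation.leibniz_pow, smul_eq_mul, nsmul_eq_mul, map_sub,
      map_add, map_neg, Derivation.map_one_eq_zero, derivation_ofNat] at hd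
    push_cast at hd
    linear_combination 12 * hd + h * (2 * x - 8 + 6 * w) * θx + 12 * h * (6 * x - 1) * θw +
      2 * (2 * (x - 1) ^ 2 + (-x ^ 2 - 4 * x + (6 * x - 1) * w)) * θh
  have hw0 : w ≠ 0 := left_ne_zero_of_mul_eq_one hwt
  -- multiplication by `w` eliminates `t`, since `1728 t w = w - 1`
  refine mul_left_cancel₀ (mul_ne_zero (ofNat_powerSeries_ne_zero K 864) hw0) ?_
  rw [hypergeometricOp]
  linear_combination w * (1 - 1728 * tSeries K) * θθθh - 8 * tSeries K * w *
    (3888 * θθh + 19872 * θh) + h * (2 * (x - 1) * (2 * (x - 1) ^ 2 +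
      (-x ^ 2 - 4 * x + (6 * x - 1) * w)) + (2 * x - 8 + 6 * w) *
      (-x ^ 2 - 4 * x + (6 * x - 1) * w) + 12 * (6 * x - 1) * (w ^ 2 - w) +
      18 * (2 * (x - 1) ^ 2 + (-x ^ 2 - 4 * x + (6 * x - 1) * w)) + 92 * (x - 1) + 60) * hwt

end DifferentialEquation

/-! ### The hypergeometric series and `E₄` -/

section HypergeometricSeries

/-- The integer `(6m)! / ((3m)! m!³)`, written as a product of binomial coefficients. -/
def hypCoeff (m : ℕ) : ℕ :=
  (6 * m).choose (3 * m) * (3 * m).choose m * m.centralBinom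

theorem hypCoeff_mul (m : ℕ) :
    hypCoeff m * (m.factorial ^ 3 * (3 * m).factorial) = (6 * m).factorial := by
  have h1 := Nat.choose_mul_factorial_mul_factorial (show 3 * m ≤ 6 * m by omega)
  have h2 := Nat.choose_mul_factorial_mul_factorial (show m ≤ 3 * m by omega)
  have h3 := Nat.choose_mul_factorial_mul_factorial (show m ≤ 2 * m by omega)
  rw [show 6 * m - 3 * m = 3 * m by omega] at h1
  rw [show 3 * m - m = 2 * m by omega] at h2
  rw [show 2 * m - m = m by omega] at h3
  rw [hypCoeff, Nat.centralBinom_eq_two_mul_choose, ← h1, ← h2, ← h3]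
  ring

variable (K : Type*) [Field K]

/-- The hypergeometric series `∑ (6m)! / ((3m)! m!³) Xᵐ`. -/
def hypSeries : K⟦X⟧ :=
  PowerSeries.mk fun m => (hypCoeff m : K)

theorem constantCoeff_hypSeries : constantCoeff (hypSeries K) = 1 := by
  rw [← coeff_zero_eq_constantCoeff_apply]
  simp [hypSeries, hypCoeff]

theorem constantCoeff_subst_tSeries (f : K⟦X⟧) :
    constantCoeff (f.subst (tSeries K)) = constantCoeff f := by
  have ht := hasSubst_tSeries K
  have h := constantCoeff_subst_eq_zero (constantCoeff_tSeries K)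
    (f - C (constantCoeff f)) (by simp)
  rw [subst_sub ht, subst_C, map_sub, sub_eq_zero] at h
  exact h.trans (constantCoeff_C _)

variable [CharZero K]

theorem hypCoeff_eq (m : ℕ) : (hypCoeff m : K) =
    ((6 * m).factorial : K) / ((m.factorial : K) ^ 3 * ((3 * m).factorial : K)) := by
  rw [← hypCoeff_mul]
  push_cast
  have h1 : (m.factorial : K) ≠ 0 := by exact_mod_cast m.factorial_ne_zero
  have h2 : ((3 * m).factorial : K) ≠ 0 := by exact_mod_cast (3 * m).factorial_ne_zero
  field_simp

theorem hypCoeff_succ (m : ℕ) : ((m : K) + 1) ^ 3 * hypCoeff (m + 1) =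
    8 * ((6 * m + 1) * (6 * m + 3) * (6 * m + 5)) * hypCoeff m := by
  have h := hypCoeff_mul m
  have h' := hypCoeff_mul (m + 1)
  rw [show 6 * (m + 1) = 6 * m + 5 + 1 by ring, show 3 * (m + 1) = 3 * m + 2 + 1 by ring] at h'
  simp only [Nat.factorial_succ] at h'
  rw [← h] at h'
  have hne : (3 * m + 2 + 1) * (3 * m + 1 + 1) * (3 * m + 1) * (m.factorial ^ 3 *
      (3 * m).factorial) ≠ 0 := by positivity
  have : (m + 1) ^ 3 * hypCoeff (m + 1) =
      8 * ((6 * m + 1) * (6 * m + 3) * (6 * m + 5)) * hypCoeff m :=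
    mul_left_cancel₀ hne (by linear_combination h')
  exact_mod_cast this

theorem hypergeometricOp_hypSeries : hypergeometricOp (euler K) X (hypSeries K) = 0 := by
  ext n
  rw [hypergeometricOp, mul_comm 8 X, mul_assoc]
  rcases n with _ | n
  · rw [map_sub, coeff_zero_X_mul]
    simp only [coeff_euler, Nat.cast_zero, zero_mul, sub_zero, map_zero]
  · rw [map_sub, coeff_succ_X_mul]
    have hC : ∀ (a : ℕ) [a.AtLeastTwo] (f : K⟦X⟧), (ofNat(a) * f).coeff n = ofNat(a) * f.coeff n :=
      fun a _ f => by rw [← map_ofNat (C (R := K)) a, coeff_C_mul]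
    simp only [hC, map_add, coeff_euler, hypSeries, coeff_mk, map_zero]
    have := hypCoeff_succ K n
    push_cast
    linear_combination this

theorem hypergeometricOp_hypSeries_subst :
    hypergeometricOp (theta K) (tSeries K) ((hypSeries K).subst (tSeries K)) = 0 := by
  have h := congrArg (substAlgHom (hasSubst_tSeries K)) (hypergeometricOp_hypSeries K)
  simp only [hypergeometricOp, map_sub, map_mul, map_add, map_ofNat, map_zero,
    substAlgHom_X, coe_substAlgHom] at h
  simpa only [hypergeometricOp, theta_subst] using h

/-- The classical formula `E₄ = ₃F₂(1/6, 1/2, 5/6; 1, 1; 1728 / j)²`. -/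
theorem hypSeries_subst_sq : ((hypSeries K).subst (tSeries K)) ^ 2 = E4 K := by
  obtain ⟨h, hh, h0⟩ := exists_sq_eq (E4 K) (constantCoeff_E4 K)
  have : h - (hypSeries K).subst (tSeries K) = 0 := by
    refine eq_zero_of_hypergeometricOp_eq_zero ?_ ?_
    · rw [map_sub, h0, constantCoeff_subst_tSeries, constantCoeff_hypSeries, sub_self]
    · have h1 := hypergeometricOp_sqrt_E4 hh
      have h2 := hypergeometricOp_hypSeries_subst K
      rw [hypergeometricOp] at h1 h2 ⊢
      simp only [map_sub]
      linear_combination h1 - h2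
  rw [← sub_eq_zero.mp this, hh]

end HypergeometricSeries

/-! ### `E₄ / (j - c)` as a differential in `1 / j` -/

section ClosedForm

variable {K : Type*} [Field K]

variable (K) in
/-- The series `1 / √(1 - 1728 X)` with coefficients in `K`. -/
def invSqrt1728 : K⟦X⟧ :=
  rescale 432 (invSqrtSeries.map (Int.castRingHom K))

theorem invSqrt1728_sq_mul : invSqrt1728 K ^ 2 * (1 - 1728 * X) = 1 := by
  have h := congrArg (rescale (432 : K)) (congrArg (PowerSeries.map (Int.castRingHom K))
    invSqrtSeries_sq_mul)
  simp only [map_mul, map_pow, map_sub, map_one, map_ofNat, map_X, rescale_X] at h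
  rw [invSqrt1728]
  linear_combination h

theorem constantCoeff_invSqrt1728 : constantCoeff (invSqrt1728 K) = 1 := by
  rw [invSqrt1728, ← coeff_zero_eq_constantCoeff_apply, coeff_rescale, pow_zero, one_mul,
    coeff_map, coeff_zero_eq_constantCoeff_apply, constantCoeff_invSqrtSeries, map_one]

/-- The geometric series `1 / (1 - c X)`. -/
def geomSeries (c : K) : K⟦X⟧ :=
  PowerSeries.mk fun n => c ^ n

theorem geomSeries_mul (c : K) : geomSeries c * (1 - C c * X) = 1 := by
  ext n
  rw [mul_sub, mul_one, map_sub, ← mul_assoc, mul_comm _ (C c), mul_assoc, coeff_C_mul, coeff_one]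
  rcases n with _ | n
  · simp [geomSeries]
  · simp [geomSeries, coeff_succ_mul_X, pow_succ']

/-- The series in `t = 1 / j` by which `q dt/dq` has to be multiplied to give `E₄ / (j - c)`. -/
def densitySeries (c : K) : K⟦X⟧ :=
  hypSeries K * invSqrt1728 K * geomSeries c

variable [CharZero K]

/-- `E₆ = G(t)³ √(1 - 1728 t)` for `G = hypSeries`: both sides have the same square, since
`E₆² = E₄³ (1 - 1728 t)` and `E₄ = G(t)²`. -/
theorem invSqrt1728_subst_mul_E6 :
    (invSqrt1728 K).subst (tSeries K) * E6 K = ((hypSeries K).subst (tSeries K)) ^ 3 := by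
  have ht := hasSubst_tSeries K
  have hb := congrArg (substAlgHom ht) (invSqrt1728_sq_mul (K := K))
  simp only [map_mul, map_pow, map_sub, map_one, map_ofNat, substAlgHom_X, coe_substAlgHom] at hb
  refine eq_of_sq_eq_sq_of_constantCoeff ?_ ?_ ?_
  · rw [mul_pow, E6_sq, ← pow_mul, mul_comm 3 2, pow_mul, hypSeries_subst_sq]
    linear_combination E4 K ^ 3 * hb
  · rw [map_mul, constantCoeff_subst_tSeries, constantCoeff_invSqrt1728, constantCoeff_E6, mul_one]
  · rw [map_pow, constantCoeff_subst_tSeries, constantCoeff_hypSeries, one_pow]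

theorem densitySeries_subst_mul (c : K) :
    (densitySeries c).subst (tSeries K) * euler K (tSeries K) * (1 - C c * tSeries K) =
      E4 K * tSeries K := by
  have ht := hasSubst_tSeries K
  have hΓ := congrArg (substAlgHom ht) (geomSeries_mul c)
  have hCc : (C c).subst (tSeries K) = C c := subst_C c
  simp only [map_mul, map_sub, map_one, substAlgHom_X, coe_substAlgHom, hCc] at hΓ
  have hd := E4_mul_euler_tSeries K
  have hG := hypSeries_subst_sq K
  have hB := invSqrt1728_subst_mul_E6 (K := K)
  rw [densitySeries, subst_mul ht, subst_mul ht]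
  set g := (hypSeries K).subst (tSeries K)
  set b := (invSqrt1728 K).subst (tSeries K)
  set γ := (geomSeries c).subst (tSeries K)
  refine mul_left_cancel₀ (E4_ne_zero K) ?_
  linear_combination g * b * γ * (1 - C c * tSeries K) * hd + g * b * E6 K * tSeries K * hΓ +
    g * tSeries K * hB + tSeries K * (g ^ 2 + E4 K) * hG

/-- As a `q`-series, `E₄ / (j - c)` is `H(t) · q dt/dq` with
`H = ∑ (6m)! / ((3m)! m!³) Xᵐ / (√(1 - 1728 X) (1 - c X))`. -/
theorem F4_eq (c : K) :
    F4 c = (((densitySeries c).subst (tSeries K) * euler K (tSeries K) : K⟦X⟧) : K⸨X⸩) := by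
  have hD : (Delta K : K⸨X⸩) ≠ 0 := by
    intro h0
    have h1 : Delta K = 0 :=
      HahnSeries.ofPowerSeries_injective (Γ := ℤ) (by rw [map_zero]; exact h0)
    simpa [h1] using (coeff_Delta K).2
  rw [F4, div_eq_iff (j_sub_ne_zero c), j, mul_sub, mul_div_assoc', eq_sub_iff_add_eq,
    eq_div_iff hD, ← HahnSeries.ofPowerSeries_C]
  simp only [← map_mul, ← map_add, ← map_pow]
  congr 1
  have h := densitySeries_subst_mul c
  rw [← tSeries_mul]
  linear_combination -E4 K ^ 3 * h

end ClosedForm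

/-! ### Multiples of `p` in a subring -/

section Multiples

variable {K : Type*} [Field K]

/-- The additive group `m R` of multiples of `m` by elements of the subring `R` of `K`. -/
def multiples (R : Subring K) (m : K) : AddSubgroup K :=
  R.toAddSubgroup.map (AddMonoidHom.mulLeft m)

theorem mul_mem_multiples {R : Subring K} {m x y : K} (hx : x ∈ multiples R m) (hy : y ∈ R) :
    x * y ∈ multiples R m := by
  obtain ⟨d, hd, rfl⟩ := hx
  exact ⟨d * y, R.mul_mem hd hy, by simp [mul_assoc]⟩

theorem intCast_mem_multiples (R : Subring K) {p : ℕ} {z : ℤ} (h : (p : ℤ) ∣ z) :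
    (z : K) ∈ multiples R (p : K) := by
  obtain ⟨d, rfl⟩ := h
  exact ⟨d, intCast_mem R d, by simp⟩

/-- If integers prime to `p` are invertible in `R`, then `pˡ / k ∈ p R` for `0 < k < pˡ`. -/
theorem primePow_div_mem_multiples {R : Subring K} [CharZero K] {p : ℕ} (hp : p.Prime)
    (hR : ∀ n : ℕ, ¬ p ∣ n → (n : K)⁻¹ ∈ R) {l k : ℕ} (hk : 0 < k) (hkl : k < p ^ l) :
    ((p ^ l : ℕ) : K) / k ∈ multiples R (p : K) := by
  obtain ⟨a, m, hm, rfl⟩ := Nat.exists_eq_pow_mul_and_not_dvd hk.ne' p hp.ne_one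
  have hal : a < l := by
    have : p ^ a < p ^ l := lt_of_le_of_lt (Nat.le_mul_of_pos_right _ (by
      rcases Nat.eq_zero_or_pos m with rfl | h
      · simp at hm
      · exact h)) hkl
    exact (Nat.pow_lt_pow_iff_right hp.one_lt).mp this
  obtain ⟨b, rfl⟩ := Nat.exists_eq_add_of_lt hal
  refine ⟨(p : K) ^ b * (m : K)⁻¹, R.mul_mem (pow_mem (natCast_mem R p) b) (hR m hm), ?_⟩
  have hp0 : (p : K) ≠ 0 := by exact_mod_cast hp.ne_zero
  have hm0 : (m : K) ≠ 0 := by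
    rintro h
    rw [Nat.cast_eq_zero] at h
    simp [h] at hm
  simp only [AddMonoidHom.coe_mulLeft]
  push_cast
  field_simp
  ring

end Multiples

/-! ### Power series with coefficients in a subring -/

section IntegralSeries

variable {K : Type*} [Field K]

/-- The subring of power series with coefficients in the subring `R` of `K`. -/
def integralSeries (R : Subring K) : Subring K⟦X⟧ :=
  (PowerSeries.map R.subtype).range

theorem mem_integralSeries {R : Subring K} {f : K⟦X⟧} :
    f ∈ integralSeries R ↔ ∀ n, f.coeff n ∈ R := by
  constructor
  · rintro ⟨g, rfl⟩ n
    rw [coeff_map]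
    exact (g.coeff n).2
  · intro h
    exact ⟨PowerSeries.mk fun n => ⟨f.coeff n, h n⟩, by ext n; simp⟩

theorem inv_mem_integralSeries {R : Subring K} {f : K⟦X⟧} (hf : f ∈ integralSeries R)
    (h0 : constantCoeff f = 1) : f⁻¹ ∈ integralSeries R := by
  obtain ⟨g, rfl⟩ := hf
  have hg : constantCoeff g = 1 := by
    apply Subtype.ext
    rw [← coeff_zero_eq_constantCoeff_apply, coeff_map] at h0
    rw [← coeff_zero_eq_constantCoeff_apply]
    exact h0
  refine ⟨invOfUnit g 1, ?_⟩
  rw [PowerSeries.eq_inv_iff_mul_eq_one (by simp [h0]), ← map_mul, mul_comm,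
    mul_invOfUnit _ _ (by simp [hg]), map_one]

theorem map_intCast_mem_integralSeries (R : Subring K) (f : ℤ⟦X⟧) :
    f.map (Int.castRingHom K) ∈ integralSeries R :=
  mem_integralSeries.mpr fun n => by
    rw [coeff_map]
    exact intCast_mem R _

/-- Only the denominator `1728 = 2⁶ 3³` of `Δ` has to be inverted for `1 / j` to be integral. -/
theorem tSeries_mem_integralSeries [CharZero K] {R : Subring K} {p : ℕ} (hp : p.Prime)
    (hp6 : ¬ p ∣ 6) (hR : ∀ n : ℕ, ¬ p ∣ n → (n : K)⁻¹ ∈ R) :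
    tSeries K ∈ integralSeries R := by
  have h4 : E4 K ∈ integralSeries R := mem_integralSeries.mpr fun n => by
    rw [E4, coeff_mk]
    split_ifs
    · exact R.one_mem
    · exact R.mul_mem (ofNat_mem R 240) (natCast_mem R _)
  have h6 : E6 K ∈ integralSeries R := mem_integralSeries.mpr fun n => by
    rw [E6, coeff_mk]
    split_ifs
    · exact R.one_mem
    · exact R.mul_mem (R.neg_mem (ofNat_mem R 504)) (natCast_mem R _)
  have h1728 : ((1728 : K))⁻¹ ∈ R := by
    have h : ¬ p ∣ 1728 := fun h => hp6 (by
      have h' : p ∣ 6 ^ 6 := h.trans (by norm_num)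
      exact hp.dvd_of_dvd_pow h')
    exact_mod_cast hR 1728 h
  have hC : C ((1728 : K)⁻¹) ∈ integralSeries R := ⟨C ⟨_, h1728⟩, by simp⟩
  rw [tSeries, Delta]
  exact mul_mem (mul_mem hC (sub_mem (pow_mem h4 3) (pow_mem h6 2)))
    (inv_mem_integralSeries (pow_mem h4 3) (by rw [map_pow, constantCoeff_E4, one_pow]))

end IntegralSeries

/-! ### Coefficients of differentials at powers of `p` -/

section Residue

variable {K : Type*} [Field K]

theorem coeff_tSeries_pow_of_lt {n k : ℕ} (h : n < k) : (tSeries K ^ k).coeff n = 0 :=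
  X_pow_dvd_iff.mp (pow_dvd_pow_of_dvd (X_dvd_iff.mpr (constantCoeff_tSeries K)) k) n h

variable [CharZero K]

theorem coeff_tSeries_pow_self (n : ℕ) : (tSeries K ^ n).coeff n = 1 := by
  obtain ⟨u, hu⟩ := X_dvd_iff.mpr (constantCoeff_tSeries K)
  have hu1 : constantCoeff u = 1 := by
    have h1 := congrArg (PowerSeries.coeff 1) (tSeries_mul K)
    rw [(coeff_Delta K).2, hu, mul_assoc, show 1 = 0 + 1 from rfl, coeff_succ_X_mul] at h1
    simpa [constantCoeff_E4] using h1
  rw [hu, mul_pow]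
  have := coeff_X_pow_mul (u ^ n) n 0
  rw [zero_add] at this
  rw [this, coeff_zero_eq_constantCoeff_apply, map_pow, hu1, one_pow]

/-- The coefficients of `H(t) · q dt/dq = q d/dq (∫ H)(t)`. -/
theorem coeff_subst_mul_euler (H : K⟦X⟧) (n : ℕ) :
    PowerSeries.coeff n (H.subst (tSeries K) * euler K (tSeries K)) =
      ∑ k ∈ Finset.range n, (n : K) / (k + 1 : ℕ) * H.coeff k * (tSeries K ^ (k + 1)).coeff n := by
  have ht := hasSubst_tSeries K
  -- the formal antiderivative of `H`
  let I : K⟦X⟧ := PowerSeries.mk fun m => H.coeff (m - 1) / m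
  have hI : derivative K I = H := by
    ext m
    rw [coeff_derivative, coeff_mk, Nat.add_sub_cancel]
    have : (m : K) + 1 ≠ 0 := by exact_mod_cast m.succ_ne_zero
    push_cast
    field_simp
  have hsupp : (Function.support fun d => I.coeff d • PowerSeries.coeff n (tSeries K ^ d)) ⊆
      (Finset.range (n + 1) : Finset ℕ) := fun d hd => by
    by_contra h
    have hlt : n < d := by simpa [Nat.lt_succ_iff] using h
    exact hd (by simp only [coeff_tSeries_pow_of_lt hlt, smul_zero])
  have h := coeff_euler (I.subst (tSeries K)) n
  rw [euler_subst ht, hI, coeff_subst' ht, finsum_eq_sum_of_support_subset _ hsupp,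
    Finset.sum_range_succ'] at h
  rw [h, show I.coeff 0 = 0 by simp [I], zero_smul, add_zero, Finset.mul_sum]
  refine Finset.sum_congr rfl fun k _ => ?_
  simp only [I, coeff_mk, Nat.add_sub_cancel, smul_eq_mul]
  ring

/-- Modulo `p` the coefficient of `q^P` in `H(t) · q dt/dq`, where `P` is a power of `p`, is the
coefficient of `t^(P-1)` in `H`. -/
theorem coeff_subst_mul_euler_sub_mem {R : Subring K} {p : ℕ} (hp : p.Prime)
    (hp6 : ¬ p ∣ 6) (hR : ∀ n : ℕ, ¬ p ∣ n → (n : K)⁻¹ ∈ R) {H : K⟦X⟧}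
    (hH : H ∈ integralSeries R) (l : ℕ) :
    PowerSeries.coeff (p ^ l) (H.subst (tSeries K) * euler K (tSeries K)) - H.coeff (p ^ l - 1) ∈
      multiples R (p : K) := by
  have hT := tSeries_mem_integralSeries hp hp6 hR
  obtain ⟨N, hN⟩ : ∃ N, p ^ l = N + 1 := Nat.exists_eq_succ_of_ne_zero (pow_ne_zero l hp.ne_zero)
  have hN0 : ((N + 1 : ℕ) : K) ≠ 0 := by exact_mod_cast N.succ_ne_zero
  rw [coeff_subst_mul_euler, hN, Finset.sum_range_succ, coeff_tSeries_pow_self, Nat.add_sub_cancel,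
    div_self hN0, one_mul, mul_one, add_sub_cancel_right]
  refine sum_mem fun k hk => ?_
  rw [Finset.mem_range] at hk
  rw [mul_assoc]
  refine mul_mem_multiples ?_ (R.mul_mem (mem_integralSeries.mp hH k)
    (mem_integralSeries.mp (pow_mem hT (k + 1)) _))
  rw [← hN]
  exact primePow_div_mem_multiples hp hR k.succ_pos (by omega)

end Residue

/-! ### Congruences for the density series -/

section Congruences

/-- Frobenius: in characteristic `p` one has `(1 - 4X)^((P-1)/2) = √(1 - 4X)^P / √(1 - 4X)`, and
`√(1 - 4X)^P = 1 + O(X^P)`, when `P` is a power of `p`. -/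
theorem dvd_coeff_sub_invSqrtSeries {p : ℕ} [Fact p.Prime] {l n : ℕ} (hn : p ^ l = 2 * n + 1)
    {i : ℕ} (hi : i < p ^ l) :
    (p : ℤ) ∣ ((1 - 4 * X : ℤ⟦X⟧) ^ n).coeff i - invSqrtSeries.coeff i := by
  let φ := Int.castRingHom (ZMod p)
  set s := sqrtSeries.map φ with hs
  set b := invSqrtSeries.map φ with hb
  have hsb : s * b = 1 := by
    rw [hs, hb, ← map_mul, sqrtSeries_mul_invSqrtSeries, map_one]
  have hpow : ((1 - 4 * X : ℤ⟦X⟧) ^ n).map φ - b = (s - 1) ^ p ^ l * b := by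
    have : CharP (ZMod p)⟦X⟧ p := charP_of_injective_ringHom C_injective p
    rw [sub_pow_char_pow, one_pow, ← sqrtSeries_sq, map_pow, map_pow, ← hs, ← pow_mul, hn, pow_succ]
    linear_combination -s ^ (2 * n) * hsb
  have hdvd : X ^ p ^ l ∣ ((1 - 4 * X : ℤ⟦X⟧) ^ n).map φ - b := by
    rw [hpow]
    refine Dvd.dvd.mul_right (pow_dvd_pow_of_dvd (X_dvd_iff.mpr ?_) _) _
    rw [map_sub, map_one, hs, ← coeff_zero_eq_constantCoeff_apply, coeff_map,
      coeff_zero_eq_constantCoeff_apply, constantCoeff_sqrtSeries, map_one, sub_self]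
  have h := X_pow_dvd_iff.mp hdvd i hi
  rw [← ZMod.intCast_zmod_eq_zero_iff_dvd]
  rw [map_sub, coeff_map, hb, coeff_map] at h
  simpa [φ] using h

/-- For `pˡ / 2 ≤ m < pˡ` a carry occurs in base `p` at the top digit when `m` is added to itself, so
`p` divides the central binomial coefficient. -/
theorem dvd_hypCoeff {p : ℕ} (hp : p.Prime) {l m : ℕ} (h : p ^ l ≤ 2 * m) (h' : m < p ^ l) :
    p ∣ hypCoeff m := by
  have hl : l ≠ 0 := by
    rintro rfl
    simp at h h'
    omega
  refine Dvd.dvd.mul_left ?_ _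
  rw [Nat.centralBinom_eq_two_mul_choose, two_mul]
  refine (hp.dvd_iff_one_le_factorization (Nat.choose_pos (by omega)).ne').mpr ?_
  rw [Nat.factorization_choose' hp (b := Nat.log p (m + m) + 1) (Nat.lt_succ_self _),
    Nat.one_le_iff_ne_zero, Finset.card_ne_zero]
  refine ⟨l, Finset.mem_filter.mpr ⟨Finset.mem_Ico.mpr ⟨by omega, ?_⟩, ?_⟩⟩
  · exact Nat.lt_succ_of_le (Nat.le_log_of_pow_le hp.one_lt (by omega))
  · rw [Nat.mod_eq_of_lt h']
    omega

variable {K : Type*} [Field K]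

/-- A polynomial `A` of degree `n` is evaluated at `1 / c` by the coefficients of index `i ≥ n`
of `A / (1 - c X)`; here `A = (1 - a X)ⁿ`. -/
theorem coeff_pow_mul_geomSeries (a : K) {c : K} (hc : c ≠ 0) (n : ℕ) {i : ℕ} (hi : n ≤ i) :
    ((1 - C a * X) ^ n * geomSeries c).coeff i = c ^ i * (1 - a * c⁻¹) ^ n := by
  induction n generalizing i with
  | zero => simp [geomSeries]
  | succ n ih =>
    obtain ⟨i, rfl⟩ := Nat.exists_eq_add_of_le' (show 1 ≤ i by omega)
    rw [show (1 - C a * X) ^ (n + 1) * geomSeries c = (1 - C a * X) ^ n * geomSeries c -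
      C a * (X * ((1 - C a * X) ^ n * geomSeries c)) by ring, map_sub, coeff_C_mul,
      coeff_succ_X_mul, ih (by omega), ih (by omega)]
    linear_combination a * c ^ i * (1 - a * c⁻¹) ^ n * mul_inv_cancel₀ hc

variable [CharZero K]

/-- The coefficient of `X^(P-1)` in `H`, where `P = 2n + 1` is a power of `p`. Modulo `p` the
factor `1 / √(1 - 1728 X)` may be replaced by `(1 - 1728 X)ⁿ` and the hypergeometric series by a
polynomial of degree `n`, so that this coefficient becomes a value at `1 / c`. -/
theorem coeff_densitySeries_sub_mem {R : Subring K} {p : ℕ} [Fact p.Prime] {c : K} (hc0 : c ≠ 0)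
    (hc : c ∈ R) (hc' : c⁻¹ ∈ R) {l n : ℕ} (hn : p ^ l = 2 * n + 1) :
    (densitySeries c).coeff (2 * n) - (c * (c - 1728)) ^ n *
      ∑ m ∈ Finset.range (p ^ l), (hypCoeff m : K) * c⁻¹ ^ m ∈ multiples R (p : K) := by
  have hp : p.Prime := Fact.out
  have hΓ : geomSeries c ∈ integralSeries R := mem_integralSeries.mpr fun i => by
    rw [geomSeries, coeff_mk]; exact pow_mem hc i
  have hG : hypSeries K ∈ integralSeries R := mem_integralSeries.mpr fun i => by
    rw [hypSeries, coeff_mk]; exact natCast_mem R _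
  set A : K⟦X⟧ := (1 - C 1728 * X) ^ n with hA
  have hAB : ∀ i < p ^ l, (invSqrt1728 K - A).coeff i ∈ multiples R (p : K) := fun i hi => by
    have h : A = rescale (432 : K) (((1 - 4 * X : ℤ⟦X⟧) ^ n).map (Int.castRingHom K)) := by
      simp only [map_mul, map_pow, map_sub, map_one, map_ofNat, map_X, rescale_X]
      rw [hA, map_ofNat]
      ring
    rw [h, invSqrt1728, map_sub, coeff_rescale, coeff_rescale, coeff_map, coeff_map, ← mul_sub,
      ← map_sub, mul_comm]
    refine mul_mem_multiples (intCast_mem_multiples R ?_) (pow_mem (ofNat_mem R 432) i)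
    rw [← dvd_neg, neg_sub]
    exact dvd_coeff_sub_invSqrtSeries hn hi
  have h1 : (densitySeries c).coeff (2 * n) - (hypSeries K * (A * geomSeries c)).coeff (2 * n) ∈
      multiples R (p : K) := by
    rw [← map_sub, densitySeries, show hypSeries K * invSqrt1728 K * geomSeries c -
      hypSeries K * (A * geomSeries c) = (invSqrt1728 K - A) * (hypSeries K * geomSeries c) by ring,
      coeff_mul]
    refine sum_mem fun x hx => mul_mem_multiples (hAB _ ?_)
      (mem_integralSeries.mp (mul_mem hG hΓ) _)
    have := Finset.HasAntidiagonal.mem_antidiagonal.mp hx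
    omega
  have hAR : A * geomSeries c ∈ integralSeries R :=
    mul_mem (pow_mem (sub_mem (one_mem _) (mul_mem (by
      rw [map_ofNat]; exact ofNat_mem _ 1728) (mem_integralSeries.mpr fun i => by
        rw [coeff_X]; split_ifs; exacts [R.one_mem, R.zero_mem]))) n) hΓ
  have h2 : (hypSeries K * (A * geomSeries c)).coeff (2 * n) - (c * (c - 1728)) ^ n *
      ∑ m ∈ Finset.range (p ^ l), (hypCoeff m : K) * c⁻¹ ^ m ∈ multiples R (p : K) := by
    rw [coeff_mul, Finset.Nat.sum_antidiagonal_eq_sum_range_succ_mk, hn, Finset.mul_sum,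
      ← Finset.sum_sub_distrib]
    refine sum_mem fun m hm => ?_
    rw [Finset.mem_range] at hm
    simp only [hypSeries, coeff_mk]
    rcases le_or_gt m n with hmn | hmn
    -- for `m ≤ n` the terms agree, as `2n - m` is at least the degree `n` of `A`
    · rw [hA, coeff_pow_mul_geomSeries _ hc0 _ (by omega)]
      convert zero_mem (multiples R (p : K)) using 1
      have e : c ^ (2 * n - m) * (1 - 1728 * c⁻¹) ^ n = (c * (c - 1728)) ^ n * c⁻¹ ^ m := by
        rw [pow_sub₀ c hc0 (by omega), pow_mul, ← inv_pow, mul_right_comm, ← mul_pow]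
        congr 2
        field_simp
      linear_combination (hypCoeff m : K) * e
    -- for `m > n` both terms are multiples of `p`
    · rw [show ∀ x y : K, (hypCoeff m : K) * x - y * ((hypCoeff m : K) * c⁻¹ ^ m) =
        (hypCoeff m : K) * (x - y * c⁻¹ ^ m) from fun x y => by ring]
      have hd : (p : ℤ) ∣ (hypCoeff m : ℤ) :=
        Int.natCast_dvd_natCast.mpr (dvd_hypCoeff hp (l := l) (by omega) (by omega))
      have hd' := intCast_mem_multiples R hd
      rw [Int.cast_natCast] at hd'
      exact mul_mem_multiples hd' (sub_mem (mem_integralSeries.mp hAR _)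
        (mul_mem (pow_mem (mul_mem hc (sub_mem hc (ofNat_mem R 1728))) n) (pow_mem hc' m)))
  have := add_mem h1 h2
  rwa [sub_add_sub_cancel] at this

/-- The congruence for the coefficients `a_{pˡ}` of `E₄ / (j - c)`, over any subring of a field of
characteristic zero in which the integers prime to `p` are invertible. -/
theorem congrIn_coeff_F4 {R : Subring K} {p : ℕ} [Fact p.Prime] (hp6 : ¬ p ∣ 6)
    (hR : ∀ n : ℕ, ¬ p ∣ n → (n : K)⁻¹ ∈ R) {c : K} (hc0 : c ≠ 0) (hc : c ∈ R) (hc' : c⁻¹ ∈ R)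
    (l : ℕ) :
    CongrIn R (p : K) (a (p ^ l) (F4 c)) ((c * (c - 1728)) ^ ((p ^ l - 1) / 2) *
      ∑ m ∈ Finset.range (p ^ l), ((6 * m).factorial : K) /
        ((m.factorial : K) ^ 3 * ((3 * m).factorial : K)) * c⁻¹ ^ m) := by
  have hp : p.Prime := Fact.out
  have hodd : Odd p := hp.odd_of_ne_two (by rintro rfl; exact hp6 (by norm_num))
  obtain ⟨n, hn⟩ := hodd.pow (n := l)
  simp only [← hypCoeff_eq]
  rw [show (p ^ l - 1) / 2 = n by omega]
  have ha : a (p ^ l) (F4 c) = PowerSeries.coeff (p ^ l)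
      ((densitySeries c).subst (tSeries K) * euler K (tSeries K)) := by
    rw [a, F4_eq]
    exact HahnSeries.ofPowerSeries_apply_coeff _ _
  have hH : densitySeries c ∈ integralSeries R := by
    refine mul_mem (mul_mem (mem_integralSeries.mpr fun i => ?_)
      (mem_integralSeries.mpr fun i => ?_)) (mem_integralSeries.mpr fun i => ?_)
    · rw [hypSeries, coeff_mk]; exact natCast_mem R _
    · rw [invSqrt1728, coeff_rescale]
      exact mul_mem (pow_mem (ofNat_mem R 432) i)
        (mem_integralSeries.mp (map_intCast_mem_integralSeries R _) i)
    · rw [geomSeries, coeff_mk]; exact pow_mem hc i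
  have h1 := coeff_subst_mul_euler_sub_mem hp hp6 hR hH l
  have h2 := coeff_densitySeries_sub_mem hc0 hc hc' hn
  rw [← ha, show p ^ l - 1 = 2 * n by omega] at h1
  have h := add_mem h1 h2
  rw [sub_add_sub_cancel] at h
  obtain ⟨d, hd, e⟩ := h
  have hy : (c * (c - 1728)) ^ n * ∑ m ∈ Finset.range (p ^ l), (hypCoeff m : K) * c⁻¹ ^ m ∈ R :=
    mul_mem (pow_mem (mul_mem hc (sub_mem hc (ofNat_mem R 1728))) n)
      (sum_mem fun m _ => mul_mem (natCast_mem R _) (pow_mem hc' m))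
  refine ⟨?_, hy, d, hd, e.symm⟩
  rw [← sub_add_cancel (a (p ^ l) (F4 c))
    ((c * (c - 1728)) ^ n * ∑ m ∈ Finset.range (p ^ l), (hypCoeff m : K) * c⁻¹ ^ m), ← e]
  exact add_mem (mul_mem (natCast_mem R p) hd) hy

end Congruences

/-! ### The rings `ZpBar` and `ZLoc` -/

section Applications

variable (p : ℕ) [Fact p.Prime]

/-- The elements of norm at most `1` are integral: the spectral norm is read off from the
coefficients of the minimal polynomial. -/
theorem mem_ZpBar_of_norm_le_one {x : PadicAlgCl p} (hx : ‖x‖ ≤ 1) : x ∈ ZpBar p := by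
  have halg : IsIntegral ℚ_[p] x := Algebra.IsIntegral.isIntegral x
  have hm := minpoly.monic halg
  have hc : ∀ n, ‖(minpoly ℚ_[p] x).coeff n‖ ≤ 1 := by
    rw [← spectralValue_le_one_iff hm]
    exact hx
  have hl : minpoly ℚ_[p] x ∈ Polynomial.lifts (algebraMap ℤ_[p] ℚ_[p]) :=
    (Polynomial.lifts_iff_coeff_lifts _).mpr fun n => ⟨⟨_, hc n⟩, rfl⟩
  obtain ⟨f, hf, -, hfm⟩ := Polynomial.lifts_and_natDegree_eq_and_monic hl hm
  have : IsIntegral ℤ_[p] x := by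
    refine ⟨f, hfm, ?_⟩
    rw [IsScalarTower.algebraMap_eq ℤ_[p] ℚ_[p] (PadicAlgCl p), ← Polynomial.eval₂_map, hf]
    exact minpoly.aeval _ _
  exact this

theorem inv_natCast_mem_ZpBar {n : ℕ} (hn : ¬ p ∣ n) : (n : PadicAlgCl p)⁻¹ ∈ ZpBar p := by
  have h : ‖(n : PadicAlgCl p)‖ = 1 := by
    have := PadicAlgCl.norm_extends p (n : ℚ_[p])
    rw [map_natCast] at this
    rw [this]
    exact Padic.norm_natCast_eq_one_iff.mpr
      ((Nat.Prime.coprime_iff_not_dvd Fact.out).mpr hn)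
  exact mem_ZpBar_of_norm_le_one p (by rw [norm_inv, h, inv_one])

theorem inv_natCast_mem_ZLoc {n : ℕ} (hn : ¬ p ∣ n) : (n : ℚ)⁻¹ ∈ ZLoc p := by
  refine Rat.padicValuation_le_one_iff.mpr ?_
  have hn0 : n ≠ 0 := by rintro rfl; simp at hn
  rw [Rat.inv_natCast_den_of_pos (Nat.pos_of_ne_zero hn0)]
  exact hn

end Applications

end MeroForm

end

theorem mainTheorem3 (p : ℕ) [Fact p.Prime] (hp : ¬ p ∣ 6) :
    (∀ c : PadicAlgCl p, c ∈ MeroForm.ZpBar p → Valued.v c = 1 → ∀ l : ℕ, 1 ≤ l →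
      MeroForm.CongrIn (MeroForm.ZpBar p) (p : PadicAlgCl p)
        (MeroForm.a (p ^ l) (MeroForm.F4 c))
        ((c * (c - 1728)) ^ ((p ^ l - 1) / 2) *
          ∑ m ∈ Finset.range (p ^ l),
            ((6 * m).factorial : PadicAlgCl p) /
              ((m.factorial : PadicAlgCl p) ^ 3 * ((3 * m).factorial : PadicAlgCl p)) *
              c⁻¹ ^ m)) ∧
    (∀ c : ℚ, Rat.padicValuation p c = 1 →
      MeroForm.CongrIn (MeroForm.ZLoc p) (p : ℚ)
        (MeroForm.a p (MeroForm.F4 c))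
        ((c * (c - 1728)) ^ ((p - 1) / 2) *
          ∑ m ∈ Finset.range p,
            ((6 * m).factorial : ℚ) / ((m.factorial : ℚ) ^ 3 * ((3 * m).factorial : ℚ)) *
              c⁻¹ ^ m)) := by
  refine ⟨fun c hc hv l _ => ?_, fun c hv => ?_⟩
  · have hn : ‖c‖ = 1 := by rw [← PadicAlgCl.valuation_coe, hv, NNReal.coe_one]
    refine MeroForm.congrIn_coeff_F4 hp (fun n => MeroForm.inv_natCast_mem_ZpBar p) ?_ hc ?_ l
    · rintro rfl
      simp at hn
    · exact MeroForm.mem_ZpBar_of_norm_le_one p (by rw [norm_inv, hn, inv_one])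
  · have hc0 : c ≠ 0 := by
      rintro rfl
      simp at hv
    have hc : c ∈ MeroForm.ZLoc p := hv.le
    have hc' : c⁻¹ ∈ MeroForm.ZLoc p := by
      change Rat.padicValuation p c⁻¹ ≤ 1
      rw [map_inv₀, hv, inv_one]
    simpa using MeroForm.congrIn_coeff_F4 hp (fun n => MeroForm.inv_natCast_mem_ZLoc p) hc0 hc hc' 1
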